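/- An $\omega$-quasi-Borel space ($\omega$qbs) is a set $X$ with an $\omega$-complete partial order and a set $M_X$ of functions $\mathbb R\to X$ (random elements) that contains the constants and is closed under precomposition with Borel maps $\mathbb R\to\mathbb R$, under countable Borel case splitting, and under pointwise suprema of $\omega$-chains. Morphisms are the Scott-continuous maps $f$ with $f\circ\alpha\in M_Y$ for all $\alpha\in M_X$. They are ordered pointwise, and the exponential $Y^X$ is the set of morphisms with the pointwise order, its random elements being the maps $\mathbb R\to Y^X$ whose uncurrying is a morphism $\mathbb R\times X\to Y$. Here $\mathbb R$ carries the discrete order and the Borel maps as random elements, $W=[0,\infty]$ the usual order and the Borel maps; $X_\bot$ is $X$ with a new least element, its random elements being the maps with Borel domain of definition that agree there with a random element of $X$ (together with the constant $\bot$). A strong monad $S$ on $\omega$qbs consists of objects $SX$, morphisms $\mathrm{return}:X\to SX$ and $\mathbin{>\!\!>\!=}:SX\times(SY)^X\to SY$ satisfying the monad laws; a monad morphism is a family of morphisms preserving $\mathrm{return}$ and $\mathbin{>\!\!>\!=}$. Let $J X=W^{W^X}$ be the continuation monad, $\mathrm{sample}:1\to J\mathbb R$, $\mathrm{sample}()[w]=\int_{[0,1]}w(r)\,dr$,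 and $\mathrm{score}:\mathbb R\to J1$, $\mathrm{score}(r)[w]=|r|\cdot w()$. A full submonad of $J$ is a strong monad $S$ with a monad morphism $m:S\to J$ whose components are order-reflecting; it contains sample and score if these factor, as morphisms, through $m_{\mathbb R}$ and $m_1$. Let $RX=(X_\bot)^{\mathbb R}$ and let $\mathbb E:RX\to JX$ be $\mathbb E_\alpha[w]=\int_{\mathrm{Dom}\,\alpha}w(\alpha(r))\,dr$. Let $TX$ be the closure of $\mathbb E[RX]\subseteq JX$ under suprema of $\omega$-chains, with the order of $JX$, and let $M_{TX}$ be the closure of $\{\mathbb E\circ\alpha : \alpha\in M_{RX}\}$ under pointwise suprema of $\omega$-chains. Proposition. (1) The unit and bind of $J$ restrict to $T$: there is a strong monad structure on $T$ for which the inclusions $\iota_X:TX\to JX$ form a monad morphism. It is a full submonad of $J$, contains sample and score, and every $TX$ is non-empty. (2) $T$ is the smallest such submonad: if $m:S\to J$ is a full submonad of $J$ that contains sample and score, then for every non-empty $X$ there is a unique morphism $h:TX\to SX$ with $m_X\circ h=\iota_X$; and if every $SX$ is non-empty (that is, if $S\emptyset\neq\emptyset$), there is a unique monad morphism $h:T\to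 S$ with $m_X\circ h_X=\iota_X$ for all $X$. (3) Let $F$ be any strong monad with morphisms $s:1\to F\mathbb R$ and $c:\mathbb R\to F1$ (for example the free one), and let $m:F\to T$ be a monad morphism that sends $s$ and $c$ to sample and score. Then for every non-empty $X$ the component $m_X$ is a densely strong epi: $M_{TX}$ is the closure of $\{m_X\circ\alpha:\alpha\in M_{FX}\}$ under pointwise suprema of $\omega$-chains. -/

import Mathlib

open MeasureTheory OmegaCompletePartialOrder
open scoped ENNReal

universe u v w z

/-- A quasi-Borel pre-domain (an `ω`-quasi-Borel space): a set with an `ω`-complete partial order and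
a set `rand` of random elements `ℝ → carrier` which contains the constants, is closed under
precomposition with measurable maps, under countable measurable case splitting, and under pointwise
suprema of `ω`-chains. A measurable `N : ℝ → ℕ` is the same as a countable partition of `ℝ` into
the Borel sets `U n = N ⁻¹' {n}`. -/
structure OmegaQBS : Type (u + 1) where
  carrier : Type u
  [cpo : OmegaCompletePartialOrder carrier]
  rand : Set (ℝ → carrier)
  const_rand : ∀ x : carrier, (fun _ => x) ∈ rand
  comp_rand : ∀ α ∈ rand, ∀ φ : ℝ → ℝ, Measurable φ → (fun r => α (φ r)) ∈ rand
  glue_rand : ∀ N : ℝ → ℕ, Measurable N → ∀ α : ℕ → ℝ → carrier, (∀ n, α n ∈ rand) →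
    (fun r => α (N r) r) ∈ rand
  sup_rand : ∀ c : Chain (ℝ → carrier), (∀ n, c n ∈ rand) → ωSup c ∈ rand

namespace OmegaQBS

instance : CoeSort OmegaQBS.{u} (Type u) := ⟨carrier⟩

instance (X : OmegaQBS.{u}) : OmegaCompletePartialOrder X := X.cpo

/-- Morphisms: Scott-continuous maps that preserve random elements. -/
@[ext]
structure Hom (X : OmegaQBS.{u}) (Y : OmegaQBS.{v}) : Type (max u v) where
  toFun : X → Y
  scott : ωScottContinuous toFun
  map_rand : ∀ α ∈ X.rand, (fun r => toFun (α r)) ∈ Y.rand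

namespace Hom

variable {X : OmegaQBS.{u}} {Y : OmegaQBS.{v}} {Z : OmegaQBS.{w}}

instance : FunLike (Hom X Y) X Y where
  coe := toFun
  coe_injective := fun _ _ h => Hom.ext h

theorem ext_apply {f g : Hom X Y} (h : ∀ x, f x = g x) : f = g := DFunLike.ext _ _ h

@[simp] theorem mk_apply (f : X → Y) (h₁ h₂) (x : X) : (Hom.mk f h₁ h₂ : Hom X Y) x = f x := rfl

theorem mono (f : Hom X Y) : Monotone f := f.scott.monotone

theorem map_sup (f : Hom X Y) (c : Chain X) : f (ωSup c) = ωSup (c.map ⟨f, f.mono⟩) :=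
  f.scott.map_ωSup c

/-- A chain-lub formulation of Scott continuity which is convenient for building morphisms. -/
theorem scott_of {f : X → Y} (hm : Monotone f)
    (hs : ∀ c : Chain X, f (ωSup c) = ωSup (c.map ⟨f, hm⟩)) : ωScottContinuous f :=
  ωScottContinuous_iff_monotone_map_ωSup.2 ⟨hm, hs⟩

/-- The pointwise order on morphisms. -/
instance : PartialOrder (Hom X Y) := PartialOrder.lift (fun f => (f : X → Y)) DFunLike.coe_injective

theorem le_def {f g : Hom X Y} : f ≤ g ↔ ∀ x, f x ≤ g x := Iff.rfl

/-- Evaluation of a chain of morphisms at a point. -/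
def evalChain (c : Chain (Hom X Y)) (x : X) : Chain Y where
  toFun n := c n x
  monotone' := fun _ _ h => c.monotone h x

@[simp] theorem evalChain_apply (c : Chain (Hom X Y)) (x : X) (n : ℕ) :
    evalChain c x n = c n x := rfl

/-- The pointwise supremum of a chain of morphisms. -/
def sup (c : Chain (Hom X Y)) : Hom X Y where
  toFun x := ωSup (evalChain c x)
  scott := by
    refine scott_of (fun x y h => ωSup_le_ωSup_of_le fun n => ⟨n, (c n).mono h⟩) fun d => ?_
    apply le_antisymm
    · refine ωSup_le _ _ fun n => ?_
      rw [evalChain_apply, map_sup]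
      refine ωSup_le _ _ fun k => ?_
      exact le_ωSup_of_le k (le_ωSup (evalChain c (d k)) n)
    · refine ωSup_le _ _ fun k => ωSup_le _ _ fun n => ?_
      exact le_ωSup_of_le n ((c n).mono (le_ωSup d k))
  map_rand α hα :=
    Y.sup_rand ⟨⟨fun n r => c n (α r), fun _ _ h r => c.monotone h (α r)⟩⟩
      fun n => (c n).map_rand α hα

instance : OmegaCompletePartialOrder (Hom X Y) where
  ωSup := sup
  le_ωSup c n x := le_ωSup (evalChain c x) n
  ωSup_le c _ h x := ωSup_le (evalChain c x) _ fun n => h n x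

theorem sup_apply (c : Chain (Hom X Y)) (x : X) : (ωSup c : Hom X Y) x = ωSup (evalChain c x) := rfl

/-- Composition of morphisms. -/
def comp (g : Hom Y Z) (f : Hom X Y) : Hom X Z where
  toFun x := g (f x)
  scott := g.scott.comp f.scott
  map_rand α hα := g.map_rand _ (f.map_rand α hα)

@[simp] theorem comp_apply (g : Hom Y Z) (f : Hom X Y) (x : X) : g.comp f x = g (f x) := rfl

end Hom

/-! ### The objects `ℝ`, `[0, ∞]` and `1` -/

/-- The points of the real line; a type of its own, so that it can carry the discrete order. -/
@[ext]
structure RealPt : Type u where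
  val : ℝ

instance : PartialOrder RealPt.{u} where
  le := Eq
  le_refl := Eq.refl
  le_trans _ _ _ := Eq.trans
  le_antisymm _ _ h _ := h

/-- The discrete `ω`-cpo on the real line. -/
instance : OmegaCompletePartialOrder RealPt.{u} where
  ωSup c := c 0
  le_ωSup c n := (c.monotone (Nat.zero_le n)).symm
  ωSup_le _ _ h := h 0

theorem RealPt.le_def {x y : RealPt.{u}} : x ≤ y ↔ x = y := Iff.rfl

/-- The pre-domain `ℝ` of real values: discrete order, Borel measurable random elements. -/
def real : OmegaQBS.{u} where
  carrier := RealPt.{u}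
  rand := {α | Measurable fun r => (α r).val}
  const_rand _ := measurable_const
  comp_rand α hα _ hφ := Measurable.comp (g := fun r => (α r).val) hα hφ
  glue_rand N hN α hα := by
    have h : Measurable fun p : ℕ × ℝ => (α p.1 p.2).val := measurable_from_prod_countable_right hα
    exact h.comp (hN.prodMk measurable_id)
  sup_rand _ h := h 0

/-- The pre-domain of weights: `[0, ∞]`, usual order, Borel measurable random elements. -/
noncomputable def weight : OmegaQBS.{0} where
  carrier := ℝ≥0∞
  cpo := inferInstance
  rand := {α | Measurable α}
  const_rand _ := measurable_const
  comp_rand _ hα _ hφ := Measurable.comp hα hφ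
  glue_rand N hN α hα := by
    have h : Measurable fun p : ℕ × ℝ => α p.1 p.2 := measurable_from_prod_countable_right hα
    exact h.comp (hN.prodMk measurable_id)
  sup_rand c h := by
    have : (ωSup c : ℝ → ℝ≥0∞) = fun r => ⨆ n, c n r := by
      funext r; rfl
    change Measurable (ωSup c : ℝ → ℝ≥0∞)
    rw [this]
    exact Measurable.iSup h

/-- The extended non-negative real number underlying a weight. -/
abbrev asENN (a : weight) : ℝ≥0∞ := a

/-- The terminal object. -/
def unit : OmegaQBS.{u} where
  carrier := PUnit.{u + 1}
  cpo :=
    { ωSup := fun _ => PUnit.unit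
      le_ωSup := fun _ _ => le_rfl
      ωSup_le := fun _ _ _ => le_rfl }
  rand := Set.univ
  const_rand _ := trivial
  comp_rand _ _ _ _ := trivial
  glue_rand _ _ _ _ := trivial
  sup_rand _ _ := trivial

/-! ### Products -/

/-- Binary product. -/
def prod (X : OmegaQBS.{u}) (Y : OmegaQBS.{v}) : OmegaQBS.{max u v} where
  carrier := X × Y
  rand := {α | (fun r => (α r).1) ∈ X.rand ∧ (fun r => (α r).2) ∈ Y.rand}
  const_rand _ := ⟨X.const_rand _, Y.const_rand _⟩
  comp_rand _ hα φ hφ := ⟨X.comp_rand _ hα.1 φ hφ, Y.comp_rand _ hα.2 φ hφ⟩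
  glue_rand N hN α hα :=
    ⟨X.glue_rand N hN (fun n r => (α n r).1) fun n => (hα n).1,
      Y.glue_rand N hN (fun n r => (α n r).2) fun n => (hα n).2⟩
  sup_rand c h :=
    ⟨X.sup_rand ⟨⟨fun n r => (c n r).1, fun _ _ hnm r => (c.monotone hnm r).1⟩⟩ fun n => (h n).1,
      Y.sup_rand ⟨⟨fun n r => (c n r).2, fun _ _ hnm r => (c.monotone hnm r).2⟩⟩ fun n => (h n).2⟩

namespace Hom

variable {X : OmegaQBS.{u}} {Y : OmegaQBS.{v}} {Z : OmegaQBS.{w}}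

/-- First projection. -/
def fst : Hom (prod X Y) X where
  toFun p := p.1
  scott := Prod.ωScottContinuous_fst
  map_rand _ h := h.1

/-- Second projection. -/
def snd : Hom (prod X Y) Y where
  toFun p := p.2
  scott := Prod.ωScottContinuous_snd
  map_rand _ h := h.2

/-- Pairing. -/
def pair (f : Hom Z X) (g : Hom Z Y) : Hom Z (prod X Y) where
  toFun z := (f z, g z)
  scott := Prod.ωScottContinuous.prodMk f.scott g.scott
  map_rand α h := ⟨f.map_rand α h, g.map_rand α h⟩

@[simp] theorem fst_apply (p : prod X Y) : (fst : Hom (prod X Y) X) p = p.1 := rfl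
@[simp] theorem snd_apply (p : prod X Y) : (snd : Hom (prod X Y) Y) p = p.2 := rfl
@[simp] theorem pair_apply (f : Hom Z X) (g : Hom Z Y) (x : Z) : pair f g x = (f x, g x) := rfl

/-- Random elements are morphisms out of the real line. -/
def ofRand (α : ℝ → X) (h : α ∈ X.rand) : Hom real.{z} X where
  toFun r := α r.val
  scott := by
    refine scott_of (fun x y h => ?_) fun c => ?_
    · rw [RealPt.le_def.1 h]
    · apply le_antisymm
      · exact le_ωSup_of_le 0 le_rfl
      · refine ωSup_le _ _ fun n => ?_
        have : c n = ωSup c := RealPt.le_def.1 (le_ωSup c n)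
        change α (c n).val ≤ α (ωSup c).val
        rw [this]
  map_rand φ hφ := X.comp_rand α h _ hφ

@[simp] theorem ofRand_apply (α : ℝ → X) (h : α ∈ X.rand) (r : RealPt.{z}) :
    ofRand α h r = α r.val := rfl

/-- A morphism out of the real line is a random element. -/
theorem rand_of_hom (f : Hom real.{z} X) : (fun r => f ⟨r⟩) ∈ X.rand :=
  f.map_rand (fun r => (⟨r⟩ : RealPt)) (measurable_id : Measurable fun r : ℝ => r)

end Hom

/-! ### Exponentials -/

/-- The exponential `Y ^ X`: morphisms with the pointwise order; its random elements are the maps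
`ℝ → (X → Y)` whose uncurrying is a morphism `ℝ × X → Y`. -/
def exp (X : OmegaQBS.{u}) (Y : OmegaQBS.{v}) : OmegaQBS.{max u v} where
  carrier := Hom X Y
  rand := {α | ∃ f : Hom (prod real.{0} X) Y, ∀ r x, α r x = f (⟨r⟩, x)}
  const_rand g := ⟨g.comp Hom.snd, fun _ _ => rfl⟩
  comp_rand := by
    rintro α ⟨f, hf⟩ φ hφ
    refine ⟨f.comp (Hom.pair ((Hom.ofRand (X := real.{0}) (fun r => ⟨φ r⟩) hφ).comp Hom.fst) Hom.snd), ?_⟩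
    intro r x
    exact hf _ _
  glue_rand := by
    intro N hN α hα
    choose f hf using hα
    refine ⟨⟨fun p => f (N p.1.val) p, ?_, ?_⟩, fun r x => hf _ _ _⟩
    · have hmono : Monotone fun p : prod real.{0} X => f (N p.1.val) p := by
        intro p q h
        have h1 : p.1 = q.1 := RealPt.le_def.1 h.1
        change f (N p.1.val) p ≤ f (N q.1.val) q
        rw [h1]
        exact (f _).mono h
      refine Hom.scott_of hmono fun c => ?_
      have h1 : ∀ n, (c n).1 = (ωSup c).1 := fun n => RealPt.le_def.1 (le_ωSup c n).1
      change f (N (ωSup c).1.val) (ωSup c) = _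
      rw [Hom.map_sup]
      apply le_antisymm
      · refine ωSup_le _ _ fun n => le_ωSup_of_le n ?_
        change f (N (ωSup c).1.val) (c n) ≤ f (N (c n).1.val) (c n)
        rw [h1 n]
      · refine ωSup_le _ _ fun n => le_ωSup_of_le n ?_
        change f (N (c n).1.val) (c n) ≤ f (N (ωSup c).1.val) (c n)
        rw [h1 n]
    · intro β hβ
      refine Y.glue_rand (fun r => N (β r).1.val) (hN.comp hβ.1) (fun n r => f n (β r)) ?_
      exact fun n => (f n).map_rand β hβ
  sup_rand := by
    intro c h
    choose f hf using h
    have hmono : Monotone f := by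
      intro n m hnm p
      have := c.monotone hnm p.1.val p.2
      exact (hf n p.1.val p.2).ge.trans (this.trans (hf m p.1.val p.2).le)
    refine ⟨ωSup (⟨⟨f, hmono⟩⟩ : Chain _), fun r x => ?_⟩
    change ωSup (Hom.evalChain _ x) = ωSup (Hom.evalChain _ _)
    congr 1
    apply Chain.ext
    funext n
    exact hf n r x

instance (X : OmegaQBS.{u}) (Y : OmegaQBS.{v}) : FunLike (exp X Y) X Y :=
  inferInstanceAs (FunLike (Hom X Y) X Y)

namespace Hom

variable {X : OmegaQBS.{u}} {Y : OmegaQBS.{v}} {Z : OmegaQBS.{w}}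

/-- Currying. -/
def curry (f : Hom (prod X Y) Z) : Hom X (exp Y Z) where
  toFun x :=
    { toFun := fun y => f (x, y)
      scott := f.scott.comp (Prod.ωScottContinuous.prodMk ωScottContinuous.const ωScottContinuous.id)
      map_rand := fun α h => f.map_rand (fun r => (x, α r)) ⟨X.const_rand x, h⟩ }
  scott := by
    refine scott_of (fun x x' h y => f.mono ⟨h, le_rfl⟩) fun c => ?_
    apply ext_apply
    intro y
    exact ωScottContinuous.map_ωSup
      (f.scott.comp (Prod.ωScottContinuous.prodMk ωScottContinuous.id (ωScottContinuous.const (x := y)))) c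
  map_rand α h :=
    ⟨f.comp (pair ((ofRand α h).comp fst) snd), fun _ _ => rfl⟩

@[simp] theorem curry_apply (f : Hom (prod X Y) Z) (x : X) (y : Y) :
    (curry f x) y = f (x, y) := rfl

/-- Evaluation. -/
def eval : Hom (prod (exp X Y) X) Y where
  toFun p := p.1 p.2
  scott := by
    refine scott_of (fun p q h => ?_) fun c => ?_
    · exact (h.1 p.2).trans ((Hom.mono (X := X) (Y := Y) (q.1)) h.2)
    · apply le_antisymm
      · refine ωSup_le _ _ fun n => ?_
        refine (map_sup (X := X) (Y := Y) (c n).1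
          (c.map ⟨Prod.snd, fun _ _ h => h.2⟩)).le.trans ?_
        refine ωSup_le _ _ fun k => le_ωSup_of_le (max n k) ?_
        change (c n).1 (c k).2 ≤
          (c (max n k)).1 (c (max n k)).2
        exact ((c.monotone (le_max_left n k)).1 _).trans
          ((Hom.mono (X := X) (Y := Y) ((c (max n k)).1)) (c.monotone (le_max_right n k)).2)
      · refine ωSup_le _ _ fun n => ?_
        have h := le_ωSup c n
        exact (h.1 _).trans ((Hom.mono (X := X) (Y := Y) ((ωSup c).1)) h.2)
  map_rand := by
    rintro α ⟨⟨f, hf⟩, h₂⟩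
    have h := f.map_rand (fun r => ((⟨r⟩ : RealPt), (α r).2))
      ⟨(measurable_id : Measurable fun r : ℝ => r), h₂⟩
    convert h using 2 with r
    exact hf r _

@[simp] theorem eval_apply (f : Hom X Y) (x : X) :
    eval ((f, x) : prod (exp X Y) X) = f x := rfl

end Hom

/-! ### Lifting -/

section WithBotChain

variable {A : Type u} [OmegaCompletePartialOrder A]

/-- The part of a chain in `WithBot A` that starts at a position where it has left `⊥`. -/
def tailChain (c : Chain (WithBot A)) (n : ℕ) (h : c n ≠ ⊥) : Chain A where
  toFun k := (c (n + k)).unbot fun e => h (le_bot_iff.1 (e ▸ c.monotone (Nat.le_add_right n k)))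
  monotone' := by
    intro i j hij
    change WithBot.unbot _ _ ≤ WithBot.unbot _ _
    rw [← WithBot.coe_le_coe, WithBot.coe_unbot, WithBot.coe_unbot]
    exact c.monotone (Nat.add_le_add_left hij n)

theorem isLUB_of_tail {c : Chain (WithBot A)} {d : Chain A} {n : ℕ}
    (h : ∀ k, c (n + k) = (d k : WithBot A)) : IsLUB (Set.range c) ((ωSup d : A) : WithBot A) := by
  constructor
  · rintro _ ⟨k, rfl⟩
    calc c k ≤ c (n + k) := c.monotone (Nat.le_add_left k n)
      _ = (d k : WithBot A) := h k
      _ ≤ _ := WithBot.coe_le_coe.2 (le_ωSup d k)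
  · intro b hb
    have h0 : (d 0 : WithBot A) ≤ b := h 0 ▸ hb ⟨n + 0, rfl⟩
    obtain ⟨a, rfl, -⟩ := WithBot.coe_le_iff.1 h0
    refine WithBot.coe_le_coe.2 (ωSup_le _ _ fun k => WithBot.coe_le_coe.1 ?_)
    exact h k ▸ hb ⟨n + k, rfl⟩

open Classical in
/-- Suprema of chains in the lifted order. -/
noncomputable def liftSup (c : Chain (WithBot A)) : WithBot A :=
  if h : ∃ n, c n ≠ ⊥ then ((ωSup (tailChain c h.choose h.choose_spec) : A) : WithBot A) else ⊥

theorem isLUB_liftSup (c : Chain (WithBot A)) : IsLUB (Set.range c) (liftSup c) := by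
  unfold liftSup
  split_ifs with h
  · exact isLUB_of_tail fun k => (WithBot.coe_unbot _ _).symm
  · push Not at h
    refine ⟨?_, fun _ _ => bot_le⟩
    rintro _ ⟨n, rfl⟩
    exact (h n).le

/-- The `ω`-cpo obtained by adjoining a new least element. -/
noncomputable instance : OmegaCompletePartialOrder (WithBot A) where
  __ := (inferInstance : PartialOrder (WithBot A))
  ωSup := liftSup
  le_ωSup c n := (isLUB_liftSup c).1 ⟨n, rfl⟩
  ωSup_le c _ h := (isLUB_liftSup c).2 (by rintro _ ⟨n, rfl⟩; exact h n)

theorem ωSup_eq_of_tail {c : Chain (WithBot A)} {d : Chain A} {n : ℕ}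
    (h : ∀ k, c (n + k) = (d k : WithBot A)) : ωSup c = ((ωSup d : A) : WithBot A) :=
  (isLUB_liftSup c).unique (isLUB_of_tail h)

theorem ωSup_ne_bot {c : Chain (WithBot A)} : ωSup c ≠ ⊥ ↔ ∃ n, c n ≠ ⊥ := by
  constructor
  · intro h
    by_contra! h'
    exact h (le_bot_iff.1 (ωSup_le _ _ fun n => (h' n).le))
  · rintro ⟨n, hn⟩ h
    exact hn (le_bot_iff.1 (h ▸ le_ωSup c n))

end WithBotChain

/-- The lifting of `X`: a new least element `⊥` is adjoined; a map `β : ℝ → X ∪ {⊥}` is a random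
element iff its domain `{r | β r ≠ ⊥}` is Borel and on its domain it agrees with a random
element of `X`. (See `mem_rand_lift`; the quantifier over `x₀` covers the empty `X` as well,
for which the constant `⊥` is the only random element.) -/
noncomputable def lift (X : OmegaQBS.{u}) : OmegaQBS.{u} where
  carrier := WithBot X
  rand := {β | MeasurableSet {r | β r ≠ ⊥} ∧ ∀ x₀ : X, (fun r => (β r).unbotD x₀) ∈ X.rand}
  const_rand b := by
    refine ⟨MeasurableSet.const _, fun x₀ => X.const_rand _⟩
  comp_rand β hβ φ hφ := ⟨hφ hβ.1, fun x₀ => X.comp_rand _ (hβ.2 x₀) φ hφ⟩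
  glue_rand N hN β hβ := by
    refine ⟨?_, fun x₀ => X.glue_rand N hN (fun n r => (β n r).unbotD x₀) fun n => (hβ n).2 x₀⟩
    have : {r | β (N r) r ≠ ⊥} = ⋃ n, (N ⁻¹' {n} ∩ {r | β n r ≠ ⊥}) := by
      ext r; simp
    rw [this]
    exact MeasurableSet.iUnion fun n => (hN (measurableSet_singleton n)).inter (hβ n).1
  sup_rand c hc := by
    classical
    refine ⟨?_, fun x₀ => ?_⟩
    · have : {r | (ωSup c : ℝ → WithBot X) r ≠ ⊥} = ⋃ n, {r | c n r ≠ ⊥} := by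
        ext r
        simp only [Set.mem_ofPred_eq, Set.mem_iUnion]
        exact ωSup_ne_bot
      rw [this]
      exact MeasurableSet.iUnion fun n => (hc n).1
    · have hp : ∀ r, ∃ n, c n r ≠ ⊥ ∨ ∀ m, c m r = ⊥ := by
        intro r
        by_cases h : ∃ n, c n r ≠ ⊥
        · exact ⟨h.choose, Or.inl h.choose_spec⟩
        · push Not at h
          exact ⟨0, Or.inr h⟩
      have hN : Measurable fun r => Nat.find (hp r) := by
        refine measurable_find hp fun k => ?_
        have hm : ∀ m, MeasurableSet {r | c m r = ⊥} := fun m => by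
          simpa [Set.compl_ofPred] using (hc m).1.compl
        have : {r | c k r ≠ ⊥ ∨ ∀ m, c m r = ⊥} =
            {r | c k r ≠ ⊥} ∪ ⋂ m, {r | c m r = ⊥} := by
          ext r; simp
        rw [this]
        exact (hc k).1.union (MeasurableSet.iInter hm)
      have hmono : Monotone fun k r => (c (Nat.find (hp r) + k) r).unbotD x₀ := by
        intro i j hij r
        rcases Nat.find_spec (hp r) with h | h
        · have hle : c (Nat.find (hp r)) r ≤ c (Nat.find (hp r) + i) r :=
            c.monotone (Nat.le_add_right _ i) r
          have hle' : c (Nat.find (hp r) + i) r ≤ c (Nat.find (hp r) + j) r :=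
            c.monotone (Nat.add_le_add_left hij _) r
          obtain ⟨a, ha⟩ := WithBot.ne_bot_iff_exists.1 h
          rw [← ha] at hle
          obtain ⟨b, hb, -⟩ := WithBot.coe_le_iff.1 hle
          rw [hb] at hle'
          obtain ⟨d, hd, hbd⟩ := WithBot.coe_le_iff.1 hle'
          change WithBot.unbotD x₀ _ ≤ WithBot.unbotD x₀ _
          rw [hb, hd]
          exact hbd
        · change WithBot.unbotD x₀ _ ≤ WithBot.unbotD x₀ _
          rw [h, h]
      have key := X.sup_rand ⟨⟨_, hmono⟩⟩ fun k =>
        X.glue_rand _ hN (fun n r => (c (n + k) r).unbotD x₀) fun n => (hc (n + k)).2 x₀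
      convert key using 1
      funext r
      rcases Nat.find_spec (hp r) with h | h
      · have e : ωSup (c.map ⟨fun β => β r, fun _ _ h => h r⟩) = _ :=
          ωSup_eq_of_tail (n := Nat.find (hp r))
            (d := Chain.map ⟨⟨_, hmono⟩⟩ ⟨fun α => α r, fun _ _ h => h r⟩) (by
              intro k
              have hle : c (Nat.find (hp r)) r ≤ c (Nat.find (hp r) + k) r :=
                c.monotone (Nat.le_add_right _ k) r
              obtain ⟨a, ha⟩ := WithBot.ne_bot_iff_exists.1 h
              rw [← ha] at hle
              obtain ⟨b, hb, -⟩ := WithBot.coe_le_iff.1 hle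
              change c (Nat.find (hp r) + k) r = ((WithBot.unbotD x₀ _ : X) : WithBot X)
              rw [hb]
              rfl)
        change WithBot.unbotD x₀ (ωSup (c.map ⟨fun β => β r, fun _ _ h => h r⟩)) = _
        rw [e]
        rfl
      · have e : ωSup (c.map ⟨fun β => β r, fun _ _ h => h r⟩) = (⊥ : WithBot X) :=
          le_bot_iff.1 (ωSup_le _ _ fun n => (h n).le)
        change WithBot.unbotD x₀ (ωSup (c.map ⟨fun β => β r, fun _ _ h => h r⟩)) = _
        rw [e]
        apply le_antisymm
        · refine le_ωSup_of_le 0 ?_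
          change x₀ ≤ WithBot.unbotD x₀ _
          rw [h]
          rfl
        · refine ωSup_le _ _ fun k => ?_
          change WithBot.unbotD x₀ _ ≤ x₀
          rw [h]
          rfl

theorem mem_rand_lift {X : OmegaQBS.{u}} {β : ℝ → WithBot X} :
    β ∈ (lift X).rand ↔ (∀ r, β r = ⊥) ∨
      ∃ B : Set ℝ, MeasurableSet B ∧ ∃ α ∈ X.rand,
        (∀ r ∈ B, β r = (α r : WithBot X)) ∧ ∀ r ∉ B, β r = ⊥ := by
  classical
  constructor
  · rintro ⟨h₁, h₂⟩
    by_cases h : ∀ r, β r = ⊥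
    · exact Or.inl h
    · push Not at h
      obtain ⟨r₀, hr₀⟩ := h
      refine Or.inr ⟨_, h₁, _, h₂ ((β r₀).unbot hr₀), fun r hr => ?_, fun r hr => not_not.1 hr⟩
      obtain ⟨a, ha⟩ := WithBot.ne_bot_iff_exists.1 hr
      rw [← ha]
      rfl
  · rintro (h | ⟨B, hB, α, hα, h₁, h₂⟩)
    · have : β = fun _ => ⊥ := funext h
      rw [this]
      exact (lift X).const_rand _
    · have hd : {r | β r ≠ ⊥} = B := by
        ext r
        by_cases hr : r ∈ B
        · simp [hr, h₁ r hr]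
        · simp [hr, h₂ r hr]
      refine ⟨hd ▸ hB, fun x₀ => ?_⟩
      have := X.glue_rand (fun r => if r ∈ B then 0 else 1)
        (Measurable.ite hB measurable_const measurable_const)
        (fun n => if n = 0 then α else fun _ => x₀)
        (by intro n; split_ifs; exacts [hα, X.const_rand _])
      convert this using 1
      funext r
      by_cases hr : r ∈ B
      · simp [hr, h₁ r hr]
      · simp [hr, h₂ r hr]

/-! ### Integration -/

namespace Hom

theorem scott_weight {X : OmegaQBS.{u}} {f : X → ℝ≥0∞} (hm : Monotone f)
    (hs : ∀ c : Chain X, f (ωSup c) ≤ ⨆ n, f (c n)) :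
    ωScottContinuous (β := weight) f := by
  refine scott_of (Y := weight) hm fun c => le_antisymm (hs c) ?_
  exact ωSup_le _ _ fun n => hm (le_ωSup c n)

theorem measurable_uncurry (f : Hom (prod real.{z} real.{z}) weight) :
    Measurable fun p : ℝ × ℝ => asENN (f (⟨p.1⟩, ⟨p.2⟩)) := by
  let e : ℝ ≃ᵐ ℝ × ℝ := PolishSpace.measurableEquivOfNotCountable
    (not_countable_iff.2 inferInstance) (not_countable_iff.2 inferInstance)
  have h : Measurable fun r : ℝ => asENN (f (⟨(e r).1⟩, ⟨(e r).2⟩)) :=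
    f.map_rand (fun r => (⟨(e r).1⟩, ⟨(e r).2⟩)) ⟨measurable_fst.comp e.measurable,
      measurable_snd.comp e.measurable⟩
  simpa [Function.comp_def] using h.comp e.symm.measurable

/-- Integration of a weight function on `ℝ` against an s-finite measure. -/
noncomputable def integral (μ : Measure ℝ) [SFinite μ] : Hom (exp real.{z} weight) weight where
  toFun g := ∫⁻ r, asENN (g ⟨r⟩) ∂μ
  scott := by
    refine scott_weight (fun g g' h => lintegral_mono fun r => h ⟨r⟩) fun c => ?_
    refine le_of_eq ?_
    refine lintegral_iSup (f := fun n r => asENN (c n ⟨r⟩)) (fun n => ?_) fun n m h r => c.monotone h ⟨r⟩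
    exact rand_of_hom (X := weight) (c n)
  map_rand β := by
    rintro ⟨f, hf⟩
    have h := measurable_uncurry.{0} (f.comp (pair fst ((ofRand.{z, 0} (X := real.{z})
      (fun r => ⟨r⟩) (measurable_id : Measurable fun r : ℝ => r)).comp snd)))
    have h' := h.lintegral_prod_right' (ν := μ)
    change Measurable fun t => ∫⁻ r, asENN (β t ⟨r⟩) ∂μ
    convert h' using 2 with t
    refine lintegral_congr fun r => ?_
    exact hf t ⟨r⟩

@[simp] theorem integral_apply (μ : Measure ℝ) [SFinite μ] (g : exp real.{z} weight) :
    integral μ g = ∫⁻ r, asENN (g ⟨r⟩) ∂μ := rfl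

/-- Multiplication of weights. -/
noncomputable def mul : Hom (prod weight weight) weight where
  toFun p := asENN p.1 * asENN p.2
  scott := by
    refine scott_weight (fun p q h => mul_le_mul' h.1 h.2) fun c => ?_
    have h : (ωSup c : prod weight weight) =
      ((⨆ n, asENN (c n).1), (⨆ n, asENN (c n).2)) := rfl
    rw [h]
    change (⨆ n, asENN (c n).1) * (⨆ n, asENN (c n).2) ≤ _
    rw [ENNReal.iSup_mul]
    refine iSup_le fun n => ?_
    rw [ENNReal.mul_iSup]
    refine iSup_le fun k => ?_
    refine le_iSup_of_le (max n k) ?_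
    exact mul_le_mul' (c.monotone (le_max_left n k)).1 (c.monotone (le_max_right n k)).2
  map_rand α h := Measurable.mul h.1 h.2

/-- Evaluation of a weight function at a point of the lifting, with value `0` at `⊥`. -/
noncomputable def extend {X : OmegaQBS.{u}} : Hom (prod (exp X weight) (lift X)) weight where
  toFun p := WithBot.recBotCoe (C := fun _ => ℝ≥0∞) 0 (fun x => asENN (p.1 x)) p.2
  scott := by
    refine scott_weight ?_ fun c => ?_
    · rintro ⟨w, b⟩ ⟨w', b'⟩ ⟨h₁, h₂⟩
      induction b using WithBot.recBotCoe with
      | bot => exact bot_le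
      | coe x =>
        obtain ⟨x', rfl, hx⟩ := WithBot.coe_le_iff.1 h₂
        exact (h₁ x).trans (Hom.mono (X := X) (Y := weight) w' hx)
    · by_cases h : ∃ n, (c n).2 ≠ (⊥ : WithBot X)
      · obtain ⟨n, hn⟩ := h
        let b : Chain (WithBot X) := c.map ⟨Prod.snd, fun _ _ h => h.2⟩
        let d : Chain X := tailChain b n hn
        have hd : ∀ k, b (n + k) = (d k : WithBot X) := fun k => (WithBot.coe_unbot _ _).symm
        have e : (ωSup c).2 = ((ωSup d : X) : WithBot X) := ωSup_eq_of_tail hd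
        rw [e]
        change (ωSup c).1 (ωSup d) ≤ _
        refine (map_sup (X := X) (Y := weight) (ωSup c).1 d).le.trans ?_
        refine ωSup_le _ _ fun k => ?_
        refine ωSup_le (evalChain (X := X) (Y := weight)
          (c.map ⟨Prod.fst, fun _ _ h => h.1⟩) (d k)) _ fun m => ?_
        refine le_iSup_of_le (α := ℝ≥0∞) (n + k + m) ?_
        have h1 : b (n + k) ≤ b (n + k + m) := b.monotone (Nat.le_add_right _ _)
        rw [hd] at h1
        obtain ⟨x', hx', hle⟩ := WithBot.coe_le_iff.1 h1
        have hx'' : (c (n + k + m)).2 = (x' : WithBot X) := hx'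
        rw [hx'']
        exact ((c.monotone (Nat.le_add_left m (n + k))).1 _).trans
          (Hom.mono (X := X) (Y := weight) (c (n + k + m)).1 hle)
      · push Not at h
        have e : (ωSup c).2 = (⊥ : WithBot X) :=
          le_bot_iff.1 (ωSup_le (α := WithBot X) (c.map ⟨Prod.snd, fun _ _ h => h.2⟩) _
            fun n => (h n).le)
        rw [e]
        exact bot_le
  map_rand α h := by
    classical
    obtain ⟨h₁, h₂⟩ := h
    rcases mem_rand_lift.1 h₂ with h | ⟨B, hB, γ, hγ, hi, ho⟩
    · have : (fun r => WithBot.recBotCoe (C := fun _ => ℝ≥0∞) 0 (fun x => asENN ((α r).1 x)) (α r).2)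
          = fun _ => 0 := by
        funext r
        rw [h r]
        rfl
      rw [this]
      exact weight.const_rand _
    · have hm : Measurable fun r => asENN ((α r).1 (γ r)) :=
        (eval (X := X) (Y := weight)).map_rand (fun r => ((α r).1, γ r)) ⟨h₁, hγ⟩
      have : (fun r => WithBot.recBotCoe (C := fun _ => ℝ≥0∞) 0 (fun x => asENN ((α r).1 x)) (α r).2)
          = fun r => if r ∈ B then asENN ((α r).1 (γ r)) else 0 := by
        funext r
        split_ifs with hr
        · rw [hi r hr]
          rfl
        · rw [ho r hr]
          rfl
      rw [this]
      exact Measurable.ite hB hm measurable_const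

end Hom

/-! ### Strong monads -/

/-- The constant morphism. -/
def Hom.const {X : OmegaQBS.{u}} {Y : OmegaQBS.{v}} (y : Y) : Hom X Y where
  toFun _ := y
  scott := ωScottContinuous.const
  map_rand _ _ := Y.const_rand y

@[simp] theorem Hom.const_apply {X : OmegaQBS.{u}} {Y : OmegaQBS.{v}} (y : Y) (x : X) :
    (Hom.const y : Hom X Y) x = y := rfl

/-- A strong monad with underlying object map `F`: units and internal binds
`F X × (F Y) ^ X → F Y`, subject to the monad laws. -/
structure StrongMonad (F : OmegaQBS.{u} → OmegaQBS.{u}) where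
  ret : ∀ X : OmegaQBS.{u}, Hom X (F X)
  bind : ∀ X Y : OmegaQBS.{u}, Hom (prod (F X) (exp X (F Y))) (F Y)
  ret_bind : ∀ (X Y : OmegaQBS.{u}) (x : X) (f : Hom X (F Y)), bind X Y (ret X x, f) = f x
  bind_ret : ∀ (X : OmegaQBS.{u}) (a : F X), bind X X (a, ret X) = a
  bind_assoc : ∀ (X Y Z : OmegaQBS.{u}) (a : F X) (f : Hom X (F Y)) (g : Hom Y (F Z)),
    bind Y Z (bind X Y (a, f), g) =
      bind X Z (a, (bind Y Z).comp (Hom.pair f (Hom.const (Y := exp Y (F Z)) g)))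

/-- Morphisms of strong monads: families of morphisms that preserve units and binds. -/
@[ext]
structure MonadHom {F G : OmegaQBS.{u} → OmegaQBS.{u}} (S : StrongMonad F) (T : StrongMonad G) where
  app : ∀ X : OmegaQBS.{u}, Hom (F X) (G X)
  map_ret : ∀ (X : OmegaQBS.{u}) (x : X), app X (S.ret X x) = T.ret X x
  map_bind : ∀ (X Y : OmegaQBS.{u}) (a : F X) (f : Hom X (F Y)),
    app Y (S.bind X Y (a, f)) = T.bind X Y (app X a, (app Y).comp f)

/-- Full monos: order-reflecting morphisms. -/
def Hom.IsFullMono {X : OmegaQBS.{u}} {Y : OmegaQBS.{v}} (f : Hom X Y) : Prop :=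
  ∀ a b : X, f a ≤ f b → a ≤ b

/-- `m : S → T` exhibits `S` as a full submonad of `T`: all its components are full monos. -/
def MonadHom.IsFull {F G : OmegaQBS.{u} → OmegaQBS.{u}} {S : StrongMonad F} {T : StrongMonad G}
    (m : MonadHom S T) : Prop :=
  ∀ X : OmegaQBS.{u}, (m.app X).IsFullMono

/-- The Kleisli arrow `k : A → G B` factors, as a morphism, through the submonad `m : S → T`. -/
def MonadHom.Contains {F G : OmegaQBS.{u} → OmegaQBS.{u}} {S : StrongMonad F} {T : StrongMonad G}
    (m : MonadHom S T) {A B : OmegaQBS.{u}} (k : Hom A (G B)) : Prop :=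
  ∃ k' : Hom A (F B), (m.app B).comp k' = k

/-! ### The continuation monad, sampling and conditioning -/

/-- `J X = [0, ∞] ^ ([0, ∞] ^ X)`. -/
noncomputable def cont (X : OmegaQBS.{u}) : OmegaQBS.{u} := exp (exp X weight) weight

noncomputable instance (X : OmegaQBS.{u}) : FunLike (cont X) (exp X weight) weight :=
  inferInstanceAs (FunLike (Hom (exp X weight) weight) (exp X weight) weight)

/-- The auxiliary morphism `(((μ, f), w), x) ↦ f x w`. -/
noncomputable def contKernel (X Y : OmegaQBS.{u}) :
    Hom (prod (prod (prod (cont X) (exp X (cont Y))) (exp Y weight)) X) weight :=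
  Hom.eval.comp (Hom.pair
    ((Hom.eval (X := X) (Y := cont Y)).comp
      (Hom.pair (Hom.snd.comp (Hom.fst.comp Hom.fst)) Hom.snd))
    (Hom.snd.comp Hom.fst))

/-- The continuation (Schwartz distribution) monad: `return x = λ w. w x` and
`μ >>= f = λ w. μ (λ x. f x w)`. -/
noncomputable def contMonad : StrongMonad cont.{u} where
  ret _ := Hom.curry (Hom.eval.comp (Hom.pair Hom.snd Hom.fst))
  bind X Y := Hom.curry (Hom.eval.comp (Hom.pair (Hom.fst.comp Hom.fst)
    (Hom.curry (contKernel X Y))))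
  ret_bind _ _ _ _ := rfl
  bind_ret _ _ := rfl
  bind_assoc _ _ _ _ _ _ := rfl

theorem contMonad_ret (X : OmegaQBS.{u}) (x : X) (w : Hom X weight) :
    (contMonad.ret X x) w = w x := rfl

theorem contMonad_bind (X Y : OmegaQBS.{u}) (μ : cont X) (f : Hom X (cont Y)) (w : Hom Y weight) :
    ∃ h : Hom X weight, (∀ x, h x = f x w) ∧
      (contMonad.bind X Y (μ, f)) w =
        μ h :=
  ⟨Hom.curry (contKernel X Y) ((μ, f), w), fun _ => rfl, rfl⟩

/-- Sampling: `sample () w = ∫ r in [0, 1], w r`. -/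
noncomputable def sample : Hom unit.{u} (cont real.{u}) :=
  Hom.curry ((Hom.integral (volume.restrict (Set.Icc (0 : ℝ) 1))).comp Hom.snd)

theorem sample_apply (w : Hom real.{u} weight) :
    (sample PUnit.unit) w =
      ∫⁻ r in Set.Icc (0 : ℝ) 1, asENN (w ⟨r⟩) := rfl

/-- The morphism `r ↦ |r|` from real values to weights. -/
noncomputable def absWeight : Hom real.{u} weight :=
  Hom.ofRand (X := weight) (fun r => ENNReal.ofReal |r|)
    (ENNReal.measurable_ofReal.comp measurable_abs : Measurable fun r : ℝ => ENNReal.ofReal |r|)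

/-- Conditioning: `score r w = |r| * w ()`. -/
noncomputable def score : Hom real.{u} (cont unit.{u}) :=
  Hom.curry (Hom.mul.comp (Hom.pair (absWeight.comp Hom.fst)
    (Hom.eval.comp (Hom.pair Hom.snd (Hom.const PUnit.unit)))))

theorem score_apply (r : ℝ) (w : Hom unit.{u} weight) :
    (score ⟨r⟩) w =
      ENNReal.ofReal |r| * asENN (w PUnit.unit) := rfl

/-! ### The powerdomain -/

/-- Randomisations of `X`: `R X = (lift X) ^ ℝ`. -/
noncomputable def randomisation (X : OmegaQBS.{u}) : OmegaQBS.{u} := exp real.{0} (lift X)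

/-- The expectation morphism `R X → J X`, sending `α` to `w ↦ ∫ r in Dom α, w (α r)`. -/
noncomputable def expectation (X : OmegaQBS.{u}) : Hom (randomisation X) (cont X) :=
  Hom.curry ((Hom.integral volume).comp (Hom.curry (Hom.extend.comp (Hom.pair
    (Hom.snd.comp Hom.fst)
    ((Hom.eval (X := real.{0}) (Y := lift X)).comp (Hom.pair (Hom.fst.comp Hom.fst) Hom.snd))))))

theorem expectation_apply (X : OmegaQBS.{u}) (α : Hom real.{0} (lift X)) (w : Hom X weight) :
    (expectation X α) w =
      ∫⁻ r : ℝ, WithBot.recBotCoe (C := fun _ => ℝ≥0∞) 0 (fun x => asENN (w x)) (α ⟨r⟩) := rfl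

/-- The closure of a subset of an `ω`-cpo under suprema of `ω`-chains. -/
inductive OmegaClosure {A : Type u} [OmegaCompletePartialOrder A] (S : Set A) : A → Prop
  | base (a : A) (h : a ∈ S) : OmegaClosure S a
  | sup (c : Chain A) (h : ∀ n, OmegaClosure S (c n)) : OmegaClosure S (ωSup c)

/-- The randomisable expectation operators. -/
def randomisable (X : OmegaQBS.{u}) : Set (cont X) := Set.range (expectation X)

/-- The randomisable random operators. -/
def randomisableRand (X : OmegaQBS.{u}) : Set (ℝ → cont X) :=
  (fun α r => expectation X (α r)) '' (randomisation X).rand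

theorem OmegaClosure.const {X : OmegaQBS.{u}} {μ : cont X} (h : OmegaClosure (randomisable X) μ) :
    OmegaClosure (randomisableRand X) fun _ => μ := by
  induction h with
  | base a h =>
    obtain ⟨α, rfl⟩ := h
    exact .base _ ⟨fun _ => α, (randomisation X).const_rand α, rfl⟩
  | sup c _ ih => exact .sup (c.map ⟨fun μ _ => μ, fun _ _ h _ => h⟩) ih

theorem OmegaClosure.comp {X : OmegaQBS.{u}} {β : ℝ → cont X} {φ : ℝ → ℝ} (hφ : Measurable φ)
    (h : OmegaClosure (randomisableRand X) β) :
    OmegaClosure (randomisableRand X) fun r => β (φ r) := by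
  induction h with
  | base a h =>
    obtain ⟨α, hα, rfl⟩ := h
    exact .base _ ⟨_, (randomisation X).comp_rand α hα φ hφ, rfl⟩
  | sup c _ ih => exact .sup (c.map ⟨fun β r => β (φ r), fun _ _ h r => h (φ r)⟩) ih

open Classical in
theorem OmegaClosure.ite {X : OmegaQBS.{u}} {β γ : ℝ → cont X} {B : Set ℝ} (hB : MeasurableSet B)
    (hβ : OmegaClosure (randomisableRand X) β) (hγ : OmegaClosure (randomisableRand X) γ) :
    OmegaClosure (randomisableRand X) fun r => if r ∈ B then β r else γ r := by
  induction hβ with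
  | base a h =>
    induction hγ with
    | base b h' =>
      obtain ⟨α, hα, rfl⟩ := h
      obtain ⟨δ, hδ, rfl⟩ := h'
      refine .base _ ⟨_, (randomisation X).glue_rand (fun r => if r ∈ B then 0 else 1)
        (Measurable.ite hB measurable_const measurable_const)
        (fun n => if n = 0 then α else δ) ?_, ?_⟩
      · intro n
        split_ifs
        exacts [hα, hδ]
      · funext r
        by_cases hr : r ∈ B <;> simp [hr]
    | sup c _ ih =>
      have hm : Monotone fun (β : ℝ → cont X) (r : ℝ) => if r ∈ B then a r else β r := by
        intro f g hfg r
        change (if r ∈ B then a r else f r) ≤ if r ∈ B then a r else g r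
        split_ifs
        exacts [le_rfl, hfg r]
      convert OmegaClosure.sup (c.map ⟨_, hm⟩) ih using 1
      funext r
      split_ifs with hr
      · apply le_antisymm
        · refine le_ωSup_of_le 0 ?_
          change a r ≤ if r ∈ B then a r else c 0 r
          rw [if_pos hr]
        · refine ωSup_le _ _ fun n => ?_
          change (if r ∈ B then a r else c n r) ≤ a r
          rw [if_pos hr]
      · change ωSup _ = ωSup _
        congr 1
        apply Chain.ext
        funext n
        change c n r = if r ∈ B then a r else c n r
        rw [if_neg hr]
  | sup c _ ih =>
    have hm : Monotone fun (β : ℝ → cont X) (r : ℝ) => if r ∈ B then β r else γ r := by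
      intro f g hfg r
      change (if r ∈ B then f r else γ r) ≤ if r ∈ B then g r else γ r
      split_ifs
      exacts [hfg r, le_rfl]
    convert OmegaClosure.sup (c.map ⟨_, hm⟩) ih using 1
    funext r
    split_ifs with hr
    · change ωSup _ = ωSup _
      congr 1
      apply Chain.ext
      funext n
      change c n r = if r ∈ B then c n r else γ r
      rw [if_pos hr]
    · apply le_antisymm
      · refine le_ωSup_of_le 0 ?_
        change γ r ≤ if r ∈ B then c 0 r else γ r
        rw [if_neg hr]
      · refine ωSup_le _ _ fun n => ?_
        change (if r ∈ B then c n r else γ r) ≤ γ r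
        rw [if_neg hr]

/-- The zero operator, which is the least element of `cont X`. -/
noncomputable def zeroOp (X : OmegaQBS.{u}) : cont X :=
  expectation X (Hom.const (X := real.{0}) (Y := lift X) (⊥ : WithBot X))

theorem zeroOp_le (X : OmegaQBS.{u}) (μ : cont X) : zeroOp X ≤ μ := by
  intro w
  have h : zeroOp X w = ∫⁻ _ : ℝ, (0 : ℝ≥0∞) := rfl
  have h0 : zeroOp X w = (0 : ℝ≥0∞) := by
    rw [h]
    exact lintegral_zero
  refine h0.le.trans ?_
  exact bot_le (α := ℝ≥0∞)

open Classical in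
theorem OmegaClosure.glue {X : OmegaQBS.{u}} {N : ℝ → ℕ} (hN : Measurable N)
    {β : ℕ → ℝ → cont X} (h : ∀ n, OmegaClosure (randomisableRand X) (β n)) :
    OmegaClosure (randomisableRand X) fun r => β (N r) r := by
  have hk : ∀ k : ℕ, OmegaClosure (randomisableRand X)
      fun r => if N r < k then β (N r) r else zeroOp X := by
    intro k
    induction k with
    | zero =>
      simpa using OmegaClosure.const (OmegaClosure.base (S := randomisable X) (zeroOp X) ⟨_, rfl⟩)
    | succ k ih =>
      convert OmegaClosure.ite (hN (measurableSet_singleton k)) (h k) ih using 1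
      funext r
      by_cases h1 : N r = k
      · simp [h1]
      · have : N r < k + 1 ↔ N r < k := by omega
        simp [h1, this]
  have hm : Monotone fun (k : ℕ) (r : ℝ) => if N r < k then β (N r) r else zeroOp X := by
    intro i j hij r
    change (if N r < i then β (N r) r else zeroOp X) ≤ if N r < j then β (N r) r else zeroOp X
    split_ifs with h1 h2
    · exact le_rfl
    · exact absurd (h1.trans_le hij) h2
    · exact zeroOp_le X _
    · exact le_rfl
  convert OmegaClosure.sup ⟨⟨_, hm⟩⟩ hk using 1
  funext r
  apply le_antisymm
  · refine le_ωSup_of_le (N r + 1) ?_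
    change β (N r) r ≤ if N r < N r + 1 then β (N r) r else zeroOp X
    rw [if_pos (Nat.lt_succ_self _)]
  · refine ωSup_le _ _ fun k => ?_
    change (if N r < k then β (N r) r else zeroOp X) ≤ β (N r) r
    split_ifs
    exacts [le_rfl, zeroOp_le X _]

/-- The statistical powerdomain `T X`: its elements are the `ω`-chain closure of the randomisable
operators in `J X`, with the order of `J X`, and its random elements are the closure of the
randomisable random operators under pointwise suprema of `ω`-chains. -/
noncomputable def powerdomain (X : OmegaQBS.{u}) : OmegaQBS.{u} where
  carrier := {μ : cont X // OmegaClosure (randomisable X) μ}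
  cpo := OmegaCompletePartialOrder.subtype _ fun c h => .sup c fun n => h _ ⟨n, rfl⟩
  rand := {β | OmegaClosure (randomisableRand X) fun r => (β r).1}
  const_rand μ := μ.2.const
  comp_rand _ hβ _ hφ := OmegaClosure.comp hφ hβ
  glue_rand _ hN _ hβ := OmegaClosure.glue hN hβ
  sup_rand c hc := OmegaClosure.sup (c.map ⟨fun β r => (β r).1, fun _ _ h r => h r⟩) hc

theorem rand_of_closure {X : OmegaQBS.{u}} {β : ℝ → cont X}
    (h : OmegaClosure (randomisableRand X) β) : β ∈ (cont X).rand := by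
  induction h with
  | base a h =>
    obtain ⟨α, hα, rfl⟩ := h
    exact (expectation X).map_rand α hα
  | sup c _ ih => exact (cont X).sup_rand c ih

/-- The inclusion of `T X` in `J X`. -/
noncomputable def inclusion (X : OmegaQBS.{u}) : Hom (powerdomain X) (cont X) where
  toFun μ := μ.1
  scott := Hom.scott_of (X := powerdomain X) (fun _ _ h => h) fun _ => rfl
  map_rand _ h := rand_of_closure h

/-- Densely strong epis: the image of the random elements is dense, for the pointwise order, in
the random elements of the codomain. -/
def Hom.IsDenselyStrongEpi {X : OmegaQBS.{u}} {Y : OmegaQBS.{v}} (f : Hom X Y) : Prop :=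
  ∀ β ∈ Y.rand, OmegaClosure ((fun α r => f (α r)) '' X.rand) β

end OmegaQBS

namespace OmegaQBS

/-! ### Transport of Lebesgue measure -/

/-! Everything rests on two facts about Lebesgue measure. The plane is a measure-preserving image of
the line (`exists_measurePreserving_plane`), so iterated integrals of partial maps are single
integrals of partial maps. Integration over the line is sampling from [0,1] followed by a finite
reweighting (`exists_lintegral_eq_lintegral_Icc`), so every expectation operator can be programmed
with sample and score.

The first fact makes T a monad. On a randomised operator, bind integrates over a partial map into
TY; if those values are themselves randomised, the result is a double integral, which the plane
lemma collapses. Monotone convergence extends this to suprema (`OmegaClosure.exists_lintegral`,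
`OmegaClosure.bind`). The monad laws are inherited from J.

The second fact gives minimality and density. A monad over J with sample and score lifts each
randomisable random operator to one of its own random elements (`exists_rand_of_randomisable`);
undefined points get score 0 and an arbitrary value, which is where non-emptiness enters. If the
monad is full, order reflection turns lifts of a chain into a chain, so the lifting passes to the
closure (`OmegaClosure.exists_rand`) and gives a morphism, unique since full monos are injective.
For density, order reflection by the inclusion of T suffices (`OmegaClosure.powerdomain_of_cont`).
-/

/-- Every probability measure on a standard Borel space is an image of Lebesgue measure on the unit
interval. -/
theorem exists_measurePreserving_Icc {Ω : Type*} [MeasurableSpace Ω] [StandardBorelSpace Ω]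
    [Nonempty Ω] (μ : Measure Ω) [IsProbabilityMeasure μ] :
    ∃ f : ℝ → Ω, MeasurePreserving f (volume.restrict (Set.Icc (0 : ℝ) 1)) μ := by
  obtain ⟨f, hf, hμ⟩ := MeasureTheory.Measure.exists_measurable_map_eq μ
  -- The map `f` lives on the subtype `[0,1]`. The projection extends it to the line; its values
  -- outside the interval do not matter, being null for the restricted measure.
  have hp : Measurable (Set.projIcc (0 : ℝ) 1 zero_le_one) := continuous_projIcc.measurable
  refine ⟨f ∘ Set.projIcc 0 1 zero_le_one, hf.comp hp, ?_⟩
  have hs : (volume : Measure (Set.Icc (0 : ℝ) 1)).map Subtype.val =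
      volume.restrict (Set.Icc (0 : ℝ) 1) :=
    (measurePreserving_subtype_coe measurableSet_Icc).map_eq
  rw [← hs, Measure.map_map (hf.comp hp) measurable_subtype_coe, ← hμ]
  congr 1
  funext x
  simp [Set.projIcc_val]

/-- Integration over the real line as sampling from `[0, 1]` with weights. -/
theorem exists_lintegral_eq_lintegral_Icc :
    ∃ g V : ℝ → ℝ, Measurable g ∧ Measurable V ∧ (∀ u, 0 ≤ V u) ∧
      ∀ F : ℝ → ℝ≥0∞, Measurable F →
        ∫⁻ s, F s = ∫⁻ u in Set.Icc (0 : ℝ) 1, ENNReal.ofReal (V u) * F (g u) := by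
  -- Importance sampling: draw from the Gaussian and weight by the inverse density. What matters is
  -- that the density is positive everywhere, so that the weight is finite, as a real-valued score
  -- requires.
  obtain ⟨g, hg⟩ := exists_measurePreserving_Icc (ProbabilityTheory.gaussianReal 0 1)
  let p : ℝ → ℝ := ProbabilityTheory.gaussianPDFReal 0 1
  have hp : Measurable p := ProbabilityTheory.measurable_gaussianPDFReal 0 1
  have hp0 : ∀ x, 0 < p x := fun x => ProbabilityTheory.gaussianPDFReal_pos 0 1 x one_ne_zero
  refine ⟨g, fun u => (p (g u))⁻¹, hg.measurable, (hp.comp hg.measurable).inv,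
    fun u => (inv_pos.2 (hp0 _)).le, fun F hF => ?_⟩
  have hm : Measurable fun x => ENNReal.ofReal (p x)⁻¹ * F x := hp.inv.ennreal_ofReal.mul hF
  rw [hg.lintegral_comp hm, ProbabilityTheory.gaussianReal_of_var_ne_zero 0 one_ne_zero,
    lintegral_withDensity_eq_lintegral_mul _ (ProbabilityTheory.measurable_gaussianPDF 0 1) hm]
  refine lintegral_congr fun x => ?_
  change F x = ENNReal.ofReal (p x) * (ENNReal.ofReal (p x)⁻¹ * F x)
  rw [← mul_assoc, ← ENNReal.ofReal_mul (hp0 x).le, mul_inv_cancel₀ (hp0 x).ne',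
    ENNReal.ofReal_one, one_mul]

/-- Splitting a real number in its integral and fractional part preserves measure. -/
theorem measurePreserving_floor_fract :
    MeasurePreserving (fun r : ℝ => (⌊r⌋, Int.fract r)) volume
      (Measure.count.prod (volume.restrict (Set.Icc (0 : ℝ) 1))) := by
  have hm : Measurable fun r : ℝ => (⌊r⌋, Int.fract r) := Int.measurable_floor.prodMk measurable_fract
  refine ⟨hm, ?_⟩
  have hv : (volume : Measure ℝ) =
      Measure.sum fun n : ℤ => volume.restrict (Set.Ico (n : ℝ) (n + 1)) := by
    rw [← Measure.restrict_iUnion (Set.pairwise_disjoint_Ico_intCast ℝ)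
      fun _ => measurableSet_Ico, iUnion_Ico_intCast, Measure.restrict_univ]
  conv_lhs => rw [hv]
  rw [Measure.map_sum hm.aemeasurable, Measure.count, Measure.prod_sum_left]
  congr 1
  funext n
  -- The half-open interval is needed for the floor to be constant on each piece; the endpoint is
  -- null. Each summand is then a translate of the unit piece.
  rw [Measure.dirac_prod, ← Measure.restrict_congr_set (Ico_ae_eq_Icc (μ := volume))]
  have he : MeasurePreserving (fun x : ℝ => x + n) (volume.restrict (Set.Ico (0 : ℝ) 1))
      (volume.restrict (Set.Ico (n : ℝ) (n + 1))) := by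
    have := (measurePreserving_add_right volume (n : ℝ)).restrict_preimage
      (s := Set.Ico (n : ℝ) (n + 1)) measurableSet_Ico
    simpa using this
  rw [← he.map_eq, Measure.map_map hm he.measurable]
  refine Measure.map_congr ?_
  filter_upwards [ae_restrict_mem measurableSet_Ico] with x hx
  have h1 : ⌊x⌋ = 0 := Int.floor_eq_zero_iff.2 hx
  simp [h1, Int.fract_eq_self.2 hx]

/-- Lebesgue measure on the plane is an image of Lebesgue measure on the line. -/
theorem exists_measurePreserving_plane :
    ∃ e : ℝ → ℝ × ℝ, MeasurePreserving e volume volume := by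
  -- The route is ℝ → ℤ × [0,1] → (ℤ × ℤ) × [0,1]² → (ℤ × [0,1])² → ℝ². Only preservation of measure
  -- is needed, so no step has to be invertible at the level of [0,1] → [0,1]².
  let ν : Measure ℝ := volume.restrict (Set.Icc (0 : ℝ) 1)
  have : IsProbabilityMeasure ν := ⟨by simp [ν]⟩
  obtain ⟨f, hf⟩ := exists_measurePreserving_Icc (ν.prod ν)
  have hg : MeasurePreserving (fun r : ℝ => (⌊r⌋, Int.fract r)) volume
    (Measure.count.prod ν) := measurePreserving_floor_fract
  have hh : MeasurePreserving (fun p : ℤ × ℝ => (p.1 : ℝ) + p.2) (Measure.count.prod ν) volume := by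
    have hm : Measurable fun p : ℤ × ℝ => (p.1 : ℝ) + p.2 := by fun_prop
    refine ⟨hm, ?_⟩
    -- Adding the floor and the fractional part back together is the identity, so the sum map pushes
    -- the product measure to Lebesgue measure.
    rw [← hg.map_eq, Measure.map_map hm hg.measurable]
    simp [Function.comp_def, Int.floor_add_fract]
  obtain ⟨k⟩ : Nonempty (ℤ ≃ ℤ × ℤ) := nonempty_equiv_of_countable
  have hk : MeasurePreserving k Measure.count (Measure.count.prod Measure.count) := by
    refine ⟨measurable_of_countable _, ?_⟩
    refine Measure.ext_of_singleton fun p => ?_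
    rw [Measure.map_apply (measurable_of_countable _) (measurableSet_singleton p),
      ← Set.singleton_prod_singleton, Measure.prod_prod, Set.singleton_prod_singleton]
    have : k ⁻¹' {p} = {k.symm p} := by ext; simp [Equiv.eq_symm_apply]
    simp [this]
  have hc : MeasurePreserving (fun p : (ℤ × ℤ) × ℝ × ℝ => ((p.1.1, p.2.1), (p.1.2, p.2.2)))
      ((Measure.count.prod Measure.count).prod (ν.prod ν))
      ((Measure.count.prod ν).prod (Measure.count.prod ν)) :=
    ((MeasurePreserving.id _).prod Measure.measurePreserving_swap).comp <|
      ((measurePreserving_prodAssoc _ _ _).symm _).comp <|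
      ((MeasurePreserving.id _).prod
        ((measurePreserving_prodAssoc _ _ _).comp Measure.measurePreserving_swap)).comp
        (measurePreserving_prodAssoc _ _ _)
  exact ⟨_, (hh.prod hh).comp (hc.comp ((hk.prod hf).comp hg))⟩

/-! ### The powerdomain as a submonad of the continuation monad -/

/-- A map on the plane which sends measurable curves to random elements is a morphism. -/
def Hom.ofPlane {X : OmegaQBS.{u}} (α : ℝ × ℝ → X)
    (h : ∀ ψ : ℝ → ℝ × ℝ, Measurable ψ → (fun r => α (ψ r)) ∈ X.rand) :
    Hom (prod real.{z} real.{z}) X where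
  toFun p := α (p.1.val, p.2.val)
  scott := by
    -- The plane has the discrete order, so Scott continuity carries no content.
    have hd : ∀ p q : prod real.{z} real.{z}, p ≤ q → p = q := fun p q h =>
      Prod.ext (RealPt.le_def.1 h.1) (RealPt.le_def.1 h.2)
    refine scott_of (fun x y h => (hd x y h ▸ le_rfl)) fun c => le_antisymm ?_ ?_
    · refine le_ωSup_of_le 0 ?_
      rw [← hd _ _ (le_ωSup c 0)]
      exact le_rfl
    · refine ωSup_le _ _ fun n => ?_
      rw [← hd _ _ (le_ωSup c n)]
      exact le_rfl
  map_rand φ hφ := h (fun r => ((φ r).1.val, (φ r).2.val)) (Measurable.prodMk hφ.1 hφ.2)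

/-- A morphism on the plane sends measurable curves to random elements. -/
theorem Hom.rand_of_plane {X : OmegaQBS.{u}} (f : Hom (prod real.{z} real.{z}) X)
    {ψ : ℝ → ℝ × ℝ} (hψ : Measurable ψ) : (fun r => f (⟨(ψ r).1⟩, ⟨(ψ r).2⟩)) ∈ X.rand :=
  f.map_rand (fun r => (⟨(ψ r).1⟩, ⟨(ψ r).2⟩)) ⟨measurable_fst.comp hψ, measurable_snd.comp hψ⟩

/-- The integrand of the expectation operator. -/
noncomputable def weightAt {X : OmegaQBS.{u}} (w : Hom X weight) (b : WithBot X) : ℝ≥0∞ :=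
  WithBot.recBotCoe (C := fun _ => ℝ≥0∞) 0 (fun x => asENN (w x)) b

@[simp] theorem weightAt_bot {X : OmegaQBS.{u}} (w : Hom X weight) : weightAt w ⊥ = 0 := rfl

@[simp] theorem weightAt_coe {X : OmegaQBS.{u}} (w : Hom X weight) (x : X) :
    weightAt w (x : WithBot X) = asENN (w x) := rfl

theorem measurable_weightAt {X : OmegaQBS.{u}} (f : Hom (prod real.{z} real.{z}) (lift X))
    (w : Hom X weight) : Measurable fun p : ℝ × ℝ => weightAt w (f (⟨p.1⟩, ⟨p.2⟩)) :=
  Hom.measurable_uncurry (Hom.extend.comp (Hom.pair (Hom.const (Y := exp X weight) w) f))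

/-- Evaluation at a parameter commutes with pointwise suprema. This is what lets `corestrict` test
random elements only: constant ones already place the values in T. -/
theorem OmegaClosure.apply {X : OmegaQBS.{u}} {β : ℝ → cont X}
    (h : OmegaClosure (randomisableRand X) β) (r : ℝ) : OmegaClosure (randomisable X) (β r) := by
  induction h with
  | base a h =>
    obtain ⟨α, -, rfl⟩ := h
    exact .base _ ⟨α r, rfl⟩
  | sup c _ ih => exact .sup (c.map ⟨fun β => β r, fun _ _ h => h r⟩) ih

theorem measurable_of_rand_cont {X : OmegaQBS.{u}} {β : ℝ → cont X} (h : β ∈ (cont X).rand)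
    (w : Hom X weight) : Measurable fun r => asENN (β r w) :=
  (Hom.eval (X := exp X weight) (Y := weight)).map_rand (fun r => (β r, w))
    ⟨h, (exp X weight).const_rand w⟩

/-- Random operators are closed under integration of a parameter. -/
theorem OmegaClosure.exists_lintegral {Y : OmegaQBS.{u}} {γ : ℝ → cont Y}
    (h : OmegaClosure (randomisableRand Y) γ) {φ : ℝ × ℝ → ℝ} (hφ : Measurable φ) :
    ∃ δ : ℝ → cont Y, OmegaClosure (randomisableRand Y) δ ∧
      ∀ r (w : Hom Y weight), asENN (δ r w) = ∫⁻ s : ℝ, asENN (γ (φ (r, s)) w) := by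
  induction h with
  | base a h =>
    obtain ⟨α, ⟨f, hf⟩, rfl⟩ := h
    -- The integral over `s` of an expectation over `t` becomes one integral over `u`, with `(s, t)
    -- = e u`.
    obtain ⟨e, he⟩ := exists_measurePreserving_plane
    have hψ : ∀ r, Measurable fun u => (φ (r, (e u).1), (e u).2) := fun r =>
      (hφ.comp (measurable_const.prodMk (measurable_fst.comp he.measurable))).prodMk
        (measurable_snd.comp he.measurable)
    let g : Hom (prod real.{0} real.{0}) (lift Y) :=
      Hom.ofPlane (fun p => f (⟨φ (p.1, (e p.2).1)⟩, ⟨(e p.2).2⟩)) fun ψ hψ =>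
        Hom.rand_of_plane f (ψ := fun u => (φ ((ψ u).1, (e (ψ u).2).1), (e (ψ u).2).2)) <| by
          have h2 : Measurable fun u => e (ψ u).2 := he.measurable.comp (measurable_snd.comp hψ)
          exact (hφ.comp ((measurable_fst.comp hψ).prodMk (measurable_fst.comp h2))).prodMk
            (measurable_snd.comp h2)
    refine ⟨fun r => expectation Y (Hom.curry g ⟨r⟩),
      .base _ ⟨fun r => Hom.curry g ⟨r⟩, ⟨g, fun _ _ => rfl⟩, rfl⟩, fun r w => ?_⟩
    have hm : Measurable fun p : ℝ × ℝ => weightAt w (f (⟨φ (r, p.1)⟩, ⟨p.2⟩)) :=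
      (measurable_weightAt f w).comp (((hφ.comp measurable_prodMk_left).comp
        measurable_fst).prodMk measurable_snd)
    calc asENN ((expectation Y (Hom.curry g ⟨r⟩)) w)
        = ∫⁻ u : ℝ, weightAt w (f (⟨φ (r, (e u).1)⟩, ⟨(e u).2⟩)) := rfl
      _ = ∫⁻ p : ℝ × ℝ, weightAt w (f (⟨φ (r, p.1)⟩, ⟨p.2⟩)) := he.lintegral_comp hm
      _ = ∫⁻ s : ℝ, ∫⁻ t : ℝ, weightAt w (f (⟨φ (r, s)⟩, ⟨t⟩)) := by
        rw [Measure.volume_eq_prod, lintegral_prod _ hm.aemeasurable]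
      _ = _ := lintegral_congr fun s => lintegral_congr fun t =>
        congrArg (weightAt w) (hf _ _).symm
  | sup c hc ih =>
    choose δ hδ h using ih
    -- The witnesses were chosen independently, but the integral formula determines their values, so
    -- they form a chain.
    have hm : Monotone δ := fun i j hij r w => (h i r w).le.trans
      ((lintegral_mono fun s => c.monotone hij _ _).trans (h j r w).ge)
    refine ⟨ωSup (⟨⟨δ, hm⟩⟩ : Chain (ℝ → cont Y)), .sup _ hδ, fun r w => ?_⟩
    calc asENN ((ωSup (⟨⟨δ, hm⟩⟩ : Chain (ℝ → cont Y)) r) w) = ⨆ n, asENN (δ n r w) := rfl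
      _ = ⨆ n, ∫⁻ s : ℝ, asENN (c n (φ (r, s)) w) := iSup_congr fun n => h n r w
      -- Monotone convergence.
      _ = ∫⁻ s : ℝ, ⨆ n, asENN (c n (φ (r, s)) w) :=
        (lintegral_iSup (fun n => (measurable_of_rand_cont (rand_of_closure (hc n)) w).comp
          (hφ.comp measurable_prodMk_left)) fun i j hij s => c.monotone hij _ _).symm

open Classical in
/-- Random operators are closed under bind. -/
theorem OmegaClosure.bind {X Y : OmegaQBS.{u}} {β : ℝ → cont X}
    (h : OmegaClosure (randomisableRand X) β) (g : Hom (prod real.{0} X) (powerdomain Y)) :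
    OmegaClosure (randomisableRand Y) fun r =>
      contMonad.bind X Y (β r, (inclusion Y).comp (Hom.curry g ⟨r⟩)) := by
  induction h with
  | base a h =>
    obtain ⟨α, ⟨f, hf⟩, rfl⟩ := h
    let e : ℝ ≃ᵐ ℝ × ℝ := PolishSpace.measurableEquivOfNotCountable
      (not_countable_iff.2 inferInstance) (not_countable_iff.2 inferInstance)
    -- Random elements have one real parameter, so `e` codes the pair of outer parameter and
    -- integration variable. `contKernel` discards its operator argument; the expectation in that
    -- slot is there only to match the unfolding of bind.
    suffices H : ∃ γ : ℝ → cont Y, OmegaClosure (randomisableRand Y) γ ∧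
        ∀ u (w : Hom Y weight), asENN (γ u w) = weightAt
          (Hom.curry (contKernel X Y)
            ((expectation X (α (e u).1), (inclusion Y).comp (Hom.curry g ⟨(e u).1⟩)), w))
          (f (⟨(e u).1⟩, ⟨(e u).2⟩)) by
      obtain ⟨γ, hγ, hγw⟩ := H
      obtain ⟨δ, hδ, hδw⟩ := hγ.exists_lintegral e.symm.measurable
      convert hδ using 1
      funext r
      apply Hom.ext_apply
      intro w
      refine Eq.trans ?_ (hδw r w).symm
      refine lintegral_congr fun s => Eq.trans ?_ (hγw _ w).symm
      rw [MeasurableEquiv.apply_symm_apply]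
      exact congrArg (weightAt _) (hf _ _)
    -- Where the randomisation is defined it agrees with a random element `a` of `X`, which `g`
    -- sends to a random element of `powerdomain Y`. Elsewhere the zero operator is glued in.
    rcases mem_rand_lift.1 (Hom.rand_of_plane f e.measurable) with h | ⟨B, hB, a, ha, hi, ho⟩
    · exact ⟨fun _ => zeroOp Y, (OmegaClosure.base (S := randomisable Y) (zeroOp Y) ⟨_, rfl⟩).const,
        fun u w => by rw [h u]; exact lintegral_zero⟩
    · have hg : OmegaClosure (randomisableRand Y) fun u => (g (⟨(e u).1⟩, a u)).1 :=
        g.map_rand (fun u => (⟨(e u).1⟩, a u)) ⟨measurable_fst.comp e.measurable, ha⟩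
      refine ⟨_, hg.ite hB
        (OmegaClosure.base (S := randomisable Y) (zeroOp Y) ⟨_, rfl⟩).const, fun u w => ?_⟩
      by_cases hu : u ∈ B
      · rw [if_pos hu, hi u hu]
        rfl
      · rw [if_neg hu, ho u hu]
        exact lintegral_zero
  | sup c _ ih =>
    -- For a fixed kernel, bind evaluates the operator at a weight function independent of it, so
    -- pointwise suprema are preserved by definition.
    exact .sup (c.map ⟨fun (β : ℝ → cont X) r =>
      contMonad.bind X Y (β r, (inclusion Y).comp (Hom.curry g ⟨r⟩)),
      fun _ _ h r => (contMonad.bind X Y).mono (Prod.mk_le_mk.2 ⟨h r, le_rfl⟩)⟩) ih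

/-- Corestriction of a morphism into `J Y` to the powerdomain. -/
noncomputable def corestrict {X Y : OmegaQBS.{u}} (f : Hom X (cont Y))
    (h : ∀ α ∈ X.rand, OmegaClosure (randomisableRand Y) fun r => f (α r)) :
    Hom X (powerdomain Y) where
  toFun x := ⟨f x, (h _ (X.const_rand x)).apply 0⟩
  scott := Hom.scott_of (Y := powerdomain Y) (fun _ _ h => f.mono h) fun c =>
    Subtype.ext (f.map_sup c)
  map_rand := h

open Classical in
/-- Operators given by integration over a measurable family of sets are random operators. -/
theorem OmegaClosure.of_setLIntegral {X : OmegaQBS.{u}} {B : Set (ℝ × ℝ)} (hB : MeasurableSet B)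
    {a : ℝ → X} (ha : a ∈ X.rand) {φ : ℝ × ℝ → ℝ} (hφ : Measurable φ) {β : ℝ → cont X}
    (h : ∀ r (w : Hom X weight),
      asENN (β r w) = ∫⁻ s in {s | (r, s) ∈ B}, asENN (w (a (φ (r, s))))) :
    OmegaClosure (randomisableRand X) β := by
  -- The set `B` becomes the domain of definition of the randomisation.
  let f : Hom (prod real.{0} real.{0}) (lift X) :=
    Hom.ofPlane (fun p => if p ∈ B then (a (φ p) : WithBot X) else (⊥ : WithBot X)) fun ψ hψ =>
      mem_rand_lift.2 <| .inr ⟨_, hψ hB, _, X.comp_rand a ha _ (hφ.comp hψ),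
        fun r hr => if_pos hr, fun r hr => if_neg hr⟩
  refine .base _ ⟨fun r => Hom.curry f ⟨r⟩, ⟨f, fun _ _ => rfl⟩, ?_⟩
  funext r
  apply Hom.ext_apply
  intro w
  refine Eq.trans ?_ (h r w).symm
  refine Eq.trans (lintegral_congr fun s => ?_)
    (lintegral_indicator (measurable_prodMk_left hB) _)
  change weightAt w (if (r, s) ∈ B then (a (φ (r, s)) : WithBot X) else ⊥) = _
  by_cases hs : (r, s) ∈ B
  · rw [if_pos hs, Set.indicator_of_mem (by exact hs)]
    rfl
  · rw [if_neg hs, Set.indicator_of_notMem (by exact hs)]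
    rfl

/-! ### The monad structure on T, with sampling and scoring -/

/-- Postcomposition with a morphism. -/
def postcomp {X Y Z : OmegaQBS.{u}} (g : Hom Y Z) : Hom (exp X Y) (exp X Z) :=
  Hom.curry (g.comp Hom.eval)

/-- The statistical monad. -/
noncomputable def powerMonad : StrongMonad powerdomain.{u} where
  -- A point mass is randomised by a constant map on [0,1], a domain of measure one.
  ret X := corestrict (contMonad.ret X) fun α hα =>
    .of_setLIntegral (B := {p | p.2 ∈ Set.Icc (0 : ℝ) 1}) (measurable_snd measurableSet_Icc) hα
      measurable_fst fun r w => by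
        change asENN (w (α r)) = ∫⁻ _ in Set.Icc (0 : ℝ) 1, asENN (w (α r))
        simp
  bind X Y := corestrict ((contMonad.bind X Y).comp
      (Hom.pair ((inclusion X).comp Hom.fst) ((postcomp (inclusion Y)).comp Hom.snd))) <| by
    rintro α ⟨h₁, g, hg⟩
    convert OmegaClosure.bind h₁ g using 1
    funext r
    refine congrArg (fun k => contMonad.bind X Y ((α r).1.1, k)) (Hom.ext_apply fun x => ?_)
    exact congrArg Subtype.val (hg r x)
  ret_bind X Y x f := Subtype.ext (contMonad.ret_bind X Y x ((inclusion Y).comp f))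
  bind_ret X a := Subtype.ext (contMonad.bind_ret X a.1)
  bind_assoc X Y Z a f g := Subtype.ext (contMonad.bind_assoc X Y Z a.1 ((inclusion Y).comp f)
    ((inclusion Z).comp g))

/-- The inclusion of the statistical monad in the continuation monad. -/
noncomputable def powerInclusion : MonadHom powerMonad contMonad.{u} where
  app := inclusion
  map_ret _ _ := rfl
  map_bind _ _ _ _ := rfl

theorem powerInclusion_isFull : powerInclusion.{u}.IsFull := fun _ _ _ h => h

theorem powerInclusion_contains_sample : powerInclusion.{u}.Contains sample :=
  ⟨corestrict sample fun _ _ =>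
    .of_setLIntegral (X := real.{u}) (B := {p | p.2 ∈ Set.Icc (0 : ℝ) 1}) (a := fun r => ⟨r⟩)
      (measurable_snd measurableSet_Icc) (measurable_id : Measurable fun r : ℝ => r)
      measurable_snd fun _ _ => rfl, rfl⟩

/-- Multiplication by |r| is integration of a constant over the interval [0,|r|], so the score is
randomised by the length of the domain. -/
theorem powerInclusion_contains_score : powerInclusion.{u}.Contains score := by
  refine ⟨corestrict score fun (α : ℝ → RealPt) (hα : Measurable fun r => (α r).val) =>
    .of_setLIntegral (X := unit.{u}) (B := {p | 0 ≤ p.2 ∧ p.2 ≤ |(α p.1).val|})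
      (a := fun _ => PUnit.unit) ?_ trivial measurable_fst fun r w => ?_, rfl⟩
  · have h : Measurable fun p : ℝ × ℝ => (α p.1).val := hα.comp measurable_fst
    exact (measurableSet_le measurable_const measurable_snd).inter
      (measurableSet_le measurable_snd (measurable_abs.comp h))
  · change ENNReal.ofReal |(α r).val| * asENN (w PUnit.unit) =
      ∫⁻ _ in Set.Icc (0 : ℝ) |(α r).val|, asENN (w PUnit.unit)
    simp [mul_comm]

/-! ### Minimality -/

/-- Composition of monad morphisms. -/
def MonadHom.comp {F G H : OmegaQBS.{u} → OmegaQBS.{u}} {S : StrongMonad F} {T : StrongMonad G}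
    {U : StrongMonad H} (n : MonadHom T U) (m : MonadHom S T) : MonadHom S U where
  app X := (n.app X).comp (m.app X)
  map_ret X x := by simp [m.map_ret, n.map_ret]
  map_bind X Y a f := by
    rw [Hom.comp_apply, m.map_bind, n.map_bind]
    rfl

/-- Extending a morphism to the lifting by an arbitrary value preserves random elements. -/
theorem rand_recBotCoe {X : OmegaQBS.{u}} {Z : OmegaQBS.{v}} (f : Hom X Z) (z₀ : Z)
    {β : ℝ → WithBot X} (hβ : β ∈ (lift X).rand) :
    (fun r => WithBot.recBotCoe (C := fun _ => Z) z₀ f (β r)) ∈ Z.rand := by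
  classical
  rcases mem_rand_lift.1 hβ with h | ⟨B, hB, a, ha, hi, ho⟩
  · simp only [h]
    exact Z.const_rand z₀
  · have := Z.glue_rand (fun r => if r ∈ B then 0 else 1)
      (Measurable.ite hB measurable_const measurable_const)
      (fun n => if n = 0 then fun r => f (a r) else fun _ => z₀)
      (by intro n; split_ifs; exacts [f.map_rand a ha, Z.const_rand _])
    convert this using 1
    funext r
    by_cases hr : r ∈ B
    · simp [hr, hi r hr]
    · simp [hr, ho r hr]

open Classical in
/-- Randomisable random operators are definable from sampling and scoring. -/
theorem exists_rand_of_randomisable {F : OmegaQBS.{u} → OmegaQBS.{u}} {S : StrongMonad F}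
    (m : MonadHom S contMonad) {sa : Hom unit.{u} (F real)} {sc : Hom real.{u} (F unit)}
    (hsa : (m.app real).comp sa = sample) (hsc : (m.app unit).comp sc = score)
    {X : OmegaQBS.{u}} (hX : Nonempty (F X)) {β : ℝ → cont X} (hβ : β ∈ randomisableRand X) :
    ∃ γ ∈ (F X).rand, (fun r => m.app X (γ r)) = β := by
  obtain ⟨α, ⟨f, hf⟩, rfl⟩ := hβ
  obtain ⟨a₀⟩ := hX
  obtain ⟨g, V, hg, hV, hV0, hgV⟩ := exists_lintegral_eq_lintegral_Icc
  let q : ℝ × ℝ → WithBot X := fun p => f (⟨p.1⟩, ⟨g p.2⟩)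
  have hq : ∀ ψ : ℝ → ℝ × ℝ, Measurable ψ → (fun r => q (ψ r)) ∈ (lift X).rand := fun ψ hψ =>
    Hom.rand_of_plane f (ψ := fun r => ((ψ r).1, g (ψ r).2))
      ((measurable_fst.comp hψ).prodMk (hg.comp (measurable_snd.comp hψ)))
  -- The program for parameter `t` samples `u`, scores by `U (t, u)` and returns the value of the
  -- randomisation at `g u`. Undefined points receive score 0.
  let U : Hom (prod real.{u} real.{u}) real.{u} :=
    Hom.ofPlane (fun p => ⟨if q p ≠ ⊥ then V p.2 else 0⟩) fun ψ hψ =>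
      Measurable.ite (hq ψ hψ).1 (hV.comp (measurable_snd.comp hψ)) measurable_const
  -- The default `a₀` need not be least in `F X`, so this is no Scott-continuous extension to the
  -- lifting; it is a morphism because its domain is discrete.
  let b : Hom (prod real.{u} real.{u}) (F X) :=
    Hom.ofPlane (fun p => WithBot.recBotCoe (C := fun _ => F X) a₀ (S.ret X) (q p)) fun ψ hψ =>
      rand_recBotCoe (S.ret X) a₀ (hq ψ hψ)
  let k : Hom (prod real.{u} real.{u}) (F X) :=
    (S.bind unit X).comp (Hom.pair (sc.comp U) (Hom.curry (b.comp Hom.fst)))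
  let γ : Hom real.{u} (F X) :=
    (S.bind real X).comp (Hom.pair (Hom.const (sa PUnit.unit)) (Hom.curry k))
  refine ⟨fun r => γ ⟨r⟩, Hom.rand_of_hom γ, ?_⟩
  have hs : m.app real (sa PUnit.unit) = sample PUnit.unit := DFunLike.congr_fun hsa PUnit.unit
  have hc : ∀ r, m.app unit (sc r) = score r := DFunLike.congr_fun hsc
  have hk : ∀ (t u : ℝ) (w : Hom X weight), asENN (m.app X (k (⟨t⟩, ⟨u⟩)) w) =
      ENNReal.ofReal (V u) * weightAt w (q (t, u)) := by
    intro t u w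
    have h1 : m.app X (k (⟨t⟩, ⟨u⟩)) = contMonad.bind unit X (score (U (⟨t⟩, ⟨u⟩)),
        (m.app X).comp (Hom.curry (b.comp Hom.fst) (⟨t⟩, ⟨u⟩))) :=
      (m.map_bind _ _ _ _).trans (congrArg (fun ν => contMonad.bind unit X
        (ν, (m.app X).comp (Hom.curry (b.comp Hom.fst) (⟨t⟩, ⟨u⟩)))) (hc _))
    have h2 : asENN (m.app X (k (⟨t⟩, ⟨u⟩)) w) =
        ENNReal.ofReal |if q (t, u) ≠ ⊥ then V u else 0| *
          asENN (m.app X (WithBot.recBotCoe (C := fun _ => F X) a₀ (S.ret X) (q (t, u))) w) := by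
      rw [h1]
      rfl
    rw [h2]
    induction q (t, u) using WithBot.recBotCoe with
    -- The score 0 annihilates whatever `a₀` contributes, even if that is infinite.
    | bot => simp
    | coe x =>
      simp only [ne_eq, WithBot.coe_ne_bot, not_false_eq_true, if_true, abs_of_nonneg (hV0 u),
        WithBot.recBotCoe_coe, m.map_ret]
      rfl
  funext t
  apply Hom.ext_apply
  intro w
  have h1 : m.app X (γ ⟨t⟩) = contMonad.bind real X (sample PUnit.unit,
      (m.app X).comp (Hom.curry k ⟨t⟩)) :=
    (m.map_bind _ _ _ _).trans (by rw [← hs]; rfl)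
  have h2 : asENN (m.app X (γ ⟨t⟩) w) =
      ∫⁻ u in Set.Icc (0 : ℝ) 1, asENN (m.app X (k (⟨t⟩, ⟨u⟩)) w) := by
    rw [h1]
    rfl
  refine h2.trans ((lintegral_congr fun u => hk t u w).trans ?_)
  -- The importance sampling identity turns the weighted integral over [0,1] back into the
  -- expectation over the line.
  refine (hgV (fun s => weightAt w (f (⟨t⟩, ⟨s⟩)))
    ((measurable_weightAt f w).comp measurable_prodMk_left)).symm.trans ?_
  exact lintegral_congr fun s => congrArg (weightAt w) (hf t ⟨s⟩).symm

/-- Random operators factor through the full submonads that contain sampling and scoring. -/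
theorem OmegaClosure.exists_rand {X Y : OmegaQBS.{u}} {m : Hom Y (cont X)} (hm : m.IsFullMono)
    (h : ∀ β ∈ randomisableRand X, ∃ γ ∈ Y.rand, (fun r => m (γ r)) = β) {β : ℝ → cont X}
    (hβ : OmegaClosure (randomisableRand X) β) : ∃ γ ∈ Y.rand, (fun r => m (γ r)) = β := by
  induction hβ with
  | base a ha => exact h a ha
  | sup c _ ih =>
    choose γ hγ hc using ih
    -- Order reflection is used here: lifts chosen separately for each index still form a chain.
    have hmono : Monotone γ := fun i j hij r => hm _ _ <|
      (congrFun (hc i) r).le.trans ((c.monotone hij r).trans (congrFun (hc j) r).ge)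
    refine ⟨_, Y.sup_rand ⟨⟨γ, hmono⟩⟩ hγ, ?_⟩
    have he : c = (⟨⟨γ, hmono⟩⟩ : Chain (ℝ → Y)).map
        ⟨fun δ r => m (δ r), fun _ _ h r => m.mono (h r)⟩ :=
      Chain.ext (funext fun n => (hc n).symm)
    rw [he]
    funext r
    exact m.map_sup _

theorem Hom.IsFullMono.injective {X : OmegaQBS.{u}} {Y : OmegaQBS.{v}} {m : Hom X Y}
    (hm : m.IsFullMono) : Function.Injective m := fun a b h =>
  le_antisymm (hm a b h.le) (hm b a h.ge)

/-- Morphisms lift along full monos when random elements do. -/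
theorem Hom.IsFullMono.existsUnique_comp_eq {X : OmegaQBS.{u}} {Y : OmegaQBS.{v}}
    {Z : OmegaQBS.{w}} {m : Hom Y Z} (hm : m.IsFullMono) (f : Hom X Z)
    (h : ∀ α ∈ X.rand, ∃ γ ∈ Y.rand, (fun r => m (γ r)) = fun r => f (α r)) :
    ∃! k : Hom X Y, m.comp k = f := by
  -- Pointwise lifts come from constant random elements. Injectivity of `m` then identifies the
  -- chosen map with every other lift, so it is continuous and preserves random elements.
  have hp : ∀ x, ∃ y, m y = f x := fun x => by
    obtain ⟨γ, -, hγ⟩ := h _ (X.const_rand x)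
    exact ⟨γ 0, congrFun hγ 0⟩
  choose k hk using hp
  have hmono : Monotone k := fun x y hxy => hm _ _ <| by
    rw [hk, hk]
    exact f.mono hxy
  refine ⟨⟨k, scott_of hmono fun c => hm.injective ?_, fun α hα => ?_⟩, ext_apply hk,
    fun k' hk' => ext_apply fun x => hm.injective ?_⟩
  · rw [hk, f.map_sup, m.map_sup]
    congr 1
    exact Chain.ext (funext fun n => (hk (c n)).symm)
  · obtain ⟨γ, hγ, he⟩ := h α hα
    convert hγ using 1
    funext r
    exact hm.injective ((hk _).trans (congrFun he r).symm)
  · exact (DFunLike.congr_fun hk' x).trans (hk x).symm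

theorem existsUnique_hom_of_contains {F : OmegaQBS.{u} → OmegaQBS.{u}} {S : StrongMonad F}
    {m : MonadHom S contMonad.{u}} (hm : m.IsFull) (hsa : m.Contains sample)
    (hsc : m.Contains score) {X : OmegaQBS.{u}} (hX : Nonempty (F X)) :
    ∃! h : Hom (powerdomain X) (F X), (m.app X).comp h = inclusion X := by
  obtain ⟨sa, hsa⟩ := hsa
  obtain ⟨sc, hsc⟩ := hsc
  exact (hm X).existsUnique_comp_eq _ fun α hα => OmegaClosure.exists_rand (hm X)
    (fun β hβ => exists_rand_of_randomisable m hsa hsc hX hβ) hα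

/-- The components are the unique lifts of the inclusions. They preserve return and bind because
both sides have the same image in J, and the components of `m` are injective. -/
theorem existsUnique_monadHom_of_contains {F : OmegaQBS.{u} → OmegaQBS.{u}} {S : StrongMonad F}
    {m : MonadHom S contMonad.{u}} (hm : m.IsFull) (hsa : m.Contains sample)
    (hsc : m.Contains score) (hF : ∀ X : OmegaQBS.{u}, Nonempty (F X)) :
    ∃! h : MonadHom powerMonad S, ∀ X : OmegaQBS.{u}, (m.app X).comp (h.app X) = inclusion X := by
  choose h hh hu using fun X => existsUnique_hom_of_contains hm hsa hsc (hF X)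
  have ha : ∀ X a, m.app X (h X a) = inclusion X a := fun X => DFunLike.congr_fun (hh X)
  refine ⟨⟨h, fun X x => (hm X).injective ?_, fun X Y a f => (hm Y).injective ?_⟩, hh,
    fun k hk => MonadHom.ext (funext fun X => hu X _ (hk X))⟩
  · rw [ha, m.map_ret]
    rfl
  · rw [ha, m.map_bind, ha]
    refine congrArg (fun k => contMonad.bind X Y (inclusion X a, k)) (Hom.ext_apply fun x => ?_)
    exact (ha Y (f x)).symm

/-! ### Density of the image -/

/-- A closure of random operators in `J X` is also a closure in `T X`. -/
theorem OmegaClosure.powerdomain_of_cont {X : OmegaQBS.{u}} {A : Set (ℝ → powerdomain X)}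
    (h : ∀ β ∈ randomisableRand X, ∃ δ ∈ A, (fun r => inclusion X (δ r)) = β)
    {β : ℝ → cont X} (hβ : OmegaClosure (randomisableRand X) β) :
    ∃ δ : ℝ → powerdomain X, OmegaClosure A δ ∧ (fun r => inclusion X (δ r)) = β := by
  induction hβ with
  | base a ha =>
    obtain ⟨δ, hδ, e⟩ := h a ha
    exact ⟨δ, .base _ hδ, e⟩
  | sup c _ ih =>
    choose δ hδ hc using ih
    -- The order of T is that of J, so no assumption on the source monad is needed to obtain a
    -- chain.
    have hmono : Monotone δ := fun i j hij r =>
      (congrFun (hc i) r).le.trans ((c.monotone hij r).trans (congrFun (hc j) r).ge)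
    refine ⟨ωSup (⟨⟨δ, hmono⟩⟩ : Chain (ℝ → powerdomain X)), .sup _ hδ, ?_⟩
    have he : c = (⟨⟨δ, hmono⟩⟩ : Chain (ℝ → powerdomain X)).map
        ⟨fun δ r => inclusion X (δ r), fun _ _ h r => (inclusion X).mono (h r)⟩ :=
      Chain.ext (funext fun n => (hc n).symm)
    rw [he]
    rfl

/-- The composite into J need not be full: `exists_rand_of_randomisable` only uses preservation of
the monad operations, and it covers the generators of the random elements of T. Suprema are then
taken in T. -/
theorem isDenselyStrongEpi_of_contains {F : OmegaQBS.{u} → OmegaQBS.{u}} {S : StrongMonad F}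
    {sa : Hom unit.{u} (F real)} {sc : Hom real.{u} (F unit)} (m : MonadHom S powerMonad.{u})
    (hsa : (inclusion real).comp ((m.app real).comp sa) = sample)
    (hsc : (inclusion unit).comp ((m.app unit).comp sc) = score)
    {X : OmegaQBS.{u}} (hX : Nonempty (F X)) : (m.app X).IsDenselyStrongEpi := by
  intro β hβ
  obtain ⟨δ, hδ, e⟩ := OmegaClosure.powerdomain_of_cont
    (A := (fun α r => m.app X (α r)) '' (F X).rand) (fun β hβ => by
      obtain ⟨γ, hγ, e⟩ := exists_rand_of_randomisable (powerInclusion.comp m) hsa hsc hX hβ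
      exact ⟨_, ⟨γ, hγ, rfl⟩, e⟩) hβ
  convert hδ using 1
  funext r
  exact Subtype.ext (congrFun e r).symm

end OmegaQBS

theorem mainTheorem8 :
    ∃ (T : OmegaQBS.StrongMonad OmegaQBS.powerdomain.{u})
      (ι : OmegaQBS.MonadHom T OmegaQBS.contMonad.{u}),
      (∀ X : OmegaQBS.{u}, ι.app X = OmegaQBS.inclusion X) ∧
      ι.IsFull ∧ ι.Contains OmegaQBS.sample ∧ ι.Contains OmegaQBS.score ∧
      (∀ X : OmegaQBS.{u}, Nonempty (OmegaQBS.powerdomain X)) ∧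
      (∀ (F : OmegaQBS.{u} → OmegaQBS.{u}) (S : OmegaQBS.StrongMonad F)
        (m : OmegaQBS.MonadHom S OmegaQBS.contMonad.{u}),
        m.IsFull → m.Contains OmegaQBS.sample → m.Contains OmegaQBS.score →
          (∀ X : OmegaQBS.{u}, Nonempty X →
            ∃! h : OmegaQBS.Hom (OmegaQBS.powerdomain X) (F X), (m.app X).comp h = ι.app X) ∧
          ((∀ X : OmegaQBS.{u}, Nonempty (F X)) →
            ∃! h : OmegaQBS.MonadHom T S,
              ∀ X : OmegaQBS.{u}, (m.app X).comp (h.app X) = ι.app X)) ∧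
      (∀ (F : OmegaQBS.{u} → OmegaQBS.{u}) (S : OmegaQBS.StrongMonad F)
        (sa : OmegaQBS.Hom OmegaQBS.unit.{u} (F OmegaQBS.real))
        (sc : OmegaQBS.Hom OmegaQBS.real.{u} (F OmegaQBS.unit)) (m : OmegaQBS.MonadHom S T),
        (ι.app OmegaQBS.real).comp ((m.app OmegaQBS.real).comp sa) = OmegaQBS.sample →
        (ι.app OmegaQBS.unit).comp ((m.app OmegaQBS.unit).comp sc) = OmegaQBS.score →
          ∀ X : OmegaQBS.{u}, Nonempty X → (m.app X).IsDenselyStrongEpi) := by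
  refine ⟨OmegaQBS.powerMonad, OmegaQBS.powerInclusion, fun _ => rfl,
    OmegaQBS.powerInclusion_isFull, OmegaQBS.powerInclusion_contains_sample,
    OmegaQBS.powerInclusion_contains_score,
    -- The zero operator, given by the nowhere defined randomisation, exists even for empty `X`.
    fun X => ⟨⟨OmegaQBS.zeroOp X, .base _ ⟨_, rfl⟩⟩⟩,
    fun F S m hm hsa hsc => ⟨fun X hX => ?_, fun hF => ?_⟩,
    fun F S sa sc m hsa hsc X hX => ?_⟩
  -- A point of `X` yields, by return, the default element of `F X` that the lifting of random
  -- operators requires.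
  · exact OmegaQBS.existsUnique_hom_of_contains hm hsa hsc (hX.map (S.ret X))
  · exact OmegaQBS.existsUnique_monadHom_of_contains hm hsa hsc hF
  · exact OmegaQBS.isDenselyStrongEpi_of_contains m hsa hsc (hX.map (S.ret X))
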